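/- Consider the following randomized CONGEST model. The network is a finite simple undirected graph $G=(V,E)$ with $n=|V|$ vertices (not necessarily connected), whose vertices are processors and whose edges are communication links. The processors have distinct IDs that are non-negative integers less than $n^k$ for a constant $k$; each processor initially knows $n$, $\varepsilon$, its ID, its degree (its links being numbered in an arbitrary order) and its own private, independent, fair coin tosses. Computation proceeds in synchronous rounds; in each round every processor performs arbitrary local computation and sends a message of $O(\log n)$ bits, possibly empty and possibly different, along each of its links. After the last round every processor outputs ACCEPT or REJECT. For $\varepsilon>0$, a graph $G=(V,E)$ is $\varepsilon$-far from a graph property $\mathcal P$ (general graph model) if $G$ does not have $\mathcal P$ and every graph on $V$ that has $\mathcal P$ differs from $G$ in at least $\varepsilon|E|$ edges (added or removed). A one-sided $\varepsilon$-tester for $\mathcal P$ is an algorithm in this model such that (i) if $G$ has $\mathcal P$, then, for every outcome of the coin tosses, all processors output ACCEPT; (ii) if $G$ is $\varepsilon$-far from $\mathcal P$, then with probability at least $2/3$ at least one processor outputs REJECT. Corollary. For each of the two properties "bipartite" and "cycle-free (acyclic)" there is a constant $C$ such that for every $k$ there is a constant $c$ such that, for every $\varepsilon>0$, there is a one-sided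 $\varepsilon$-tester for the property in the randomized CONGEST model which, on every network with $n$ processors and distinct IDs less than $n^k$, uses at most $C\cdot(\log n)/\varepsilon$ rounds and messages of at most $c\log n$ bits. -/

import Mathlib

universe u

namespace Congest

/-- A network on the graph `G`: every processor has a distinct ID, and the links at `v` are
numbered by the ports `0, …, deg v - 1` in an arbitrary order. -/
structure Network {V : Type u} (G : SimpleGraph V) where
  id : V → ℕ
  id_injective : Function.Injective id
  deg : V → ℕ
  port : ∀ v, Fin (deg v) ≃ G.neighborSet v

/-- A message of at most `B` bits. -/
abbrev Message (B : ℕ) : Type := {l : List Bool // l.length ≤ B}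

/-- The empty message. -/
def Message.empty (B : ℕ) : Message B := ⟨[], Nat.zero_le B⟩

/-- A randomized CONGEST program, executed by every processor. A processor starts knowing only its
ID, its degree and its private coin tosses. In each round it sends, through each of its ports, a
message of at most `bandwidth` bits (depending on the port), and then updates its state from the
messages received, indexed by port. After `rounds` rounds it outputs `true` (ACCEPT) or
`false` (REJECT). Local computation is unrestricted. -/
structure Program where
  bandwidth : ℕ
  rounds : ℕ
  coins : ℕ
  State : Type
  init : (id deg : ℕ) → (Fin coins → Bool) → State
  send : State → (port : ℕ) → Message bandwidth
  receive : State → (inbox : ℕ → Message bandwidth) → State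
  output : State → Bool

/-- Outcomes of the private coin tosses of all processors. -/
abbrev Program.Coins (A : Program) (V : Type u) : Type u := V → Fin A.coins → Bool

/-- The messages that `v` receives, by port, when each processor `u` sends `out u q` through its
port `q`: at port `p`, leading to the neighbor `u`, `v` receives what `u` sends through the
port of `u` that leads to `v`. -/
def inbox {V : Type u} {G : SimpleGraph V} (N : Network G) {B : ℕ} (out : V → ℕ → Message B)
    (v : V) (p : ℕ) : Message B :=
  if h : p < N.deg v then
    out (N.port v ⟨p, h⟩)
      ((N.port (N.port v ⟨p, h⟩)).symm ⟨v, (N.port v ⟨p, h⟩).2.symm⟩)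
  else Message.empty B

/-- The state of each processor after `t` synchronous rounds. -/
def Program.run (A : Program) {V : Type u} {G : SimpleGraph V} (N : Network G)
    (ω : A.Coins V) : ℕ → V → A.State
  | 0 => fun v => A.init (N.id v) (N.deg v) (ω v)
  | t + 1 => fun v =>
      A.receive (A.run N ω t v) (inbox N (fun u => A.send (A.run N ω t u)) v)

/-- The output of the processor `v`; `true` means ACCEPT. -/
def Program.result (A : Program) {V : Type u} {G : SimpleGraph V} (N : Network G)
    (ω : A.Coins V) (v : V) : Bool :=
  A.output (A.run N ω A.rounds v)

/-- The probability of an event when all coin tosses are fair and independent. -/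
noncomputable def Program.prob (A : Program) {V : Type u} (S : Set (A.Coins V)) : ℝ :=
  (S.ncard : ℝ) / (Nat.card (A.Coins V) : ℝ)

/-- `G` is `ε`-far (in the general graph model) from the property `P`: it lacks `P`, and at least
`ε * |E(G)|` edges must be added or removed to obtain `P`. The first clause matters only for
graphs without edges. -/
def IsFar {V : Type u} (P : SimpleGraph V → Prop) (ε : ℝ) (G : SimpleGraph V) : Prop :=
  ¬ P G ∧ ∀ H : SimpleGraph V, P H →
    ε * (G.edgeSet.ncard : ℝ) ≤ ((symmDiff G.edgeSet H.edgeSet).ncard : ℝ)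

/-- `A n` being the program for networks with `n` processors, `A` is a one-sided `ε`-tester for `P`
on networks whose IDs are smaller than `n ^ k`. -/
def IsOneSidedTester (P : ∀ V : Type u, SimpleGraph V → Prop) (k : ℕ) (ε : ℝ)
    (A : ℕ → Program) : Prop :=
  ∀ (V : Type u) [Fintype V] (G : SimpleGraph V) (N : Network G),
    (∀ v, N.id v < Fintype.card V ^ k) →
      (P V G → ∀ (ω : (A (Fintype.card V)).Coins V) (v : V),
        (A (Fintype.card V)).result N ω v = true) ∧
      (IsFar (P V) ε G →
        2 / 3 ≤ (A (Fintype.card V)).prob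
          {ω : (A (Fintype.card V)).Coins V | ∃ v, (A (Fintype.card V)).result N ω v = false})

/-- For every `ε > 0` there is a one-sided `ε`-tester for `P` in the randomized CONGEST model that
takes `O((log n) / ε)` rounds. The constant `C` of the round complexity is absolute; the constant
`c` of the message length may depend on the exponent `k` that bounds the IDs. -/
def HasLogTester (P : ∀ V : Type u, SimpleGraph V → Prop) : Prop :=
  ∃ C : ℝ, ∀ k : ℕ, ∃ c : ℝ, ∀ ε : ℝ, 0 < ε →
    ∃ A : ℕ → Program,
      (∀ n : ℕ, ((A n).bandwidth : ℝ) ≤ c * Real.log n) ∧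
      (∀ n : ℕ, ((A n).rounds : ℝ) ≤ C * (Real.log n / ε)) ∧
      IsOneSidedTester P k ε A

end Congest

/-! The tester clusters the graph with randomly shifted starts and checks each cluster against its
breadth-first depths. Every processor `w` draws a truncated geometric strength `r w ≤ R`, and `v`
joins the reachable center maximizing `r w - dist v w` among those with `dist v w ≤ r w`, ties being
broken by ID. Flooding the largest token for `R` rounds tells `v` its center and its exact distance
from it (`exists_isCenter`).

One-sidedness: depths are true distances in `G`, so in a bipartite or acyclic graph the local checks
cannot fail, whatever the coins. Conversely, if all checks pass, the graph of uncut edges has the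
property (`IsCertificate`).

Few edges are cut: measure distances from an edge. If the best center leads by more than one step,
both endpoints choose it (`Leads.isCenter_of_adj`). Fix the strengths of all others: a center that
leads at all leads by one step more with conditional probability at least `1 - 1 / 2 ^ j`, by
memorylessness, up to the truncation error. Summing over centers (`IsGeometric.card_exists_leads`),
an edge is cut with probability at most `2 / 2 ^ j ≤ ε / 3`. By Markov, at least `ε |E|` edges are
cut with probability at most `1 / 3`; otherwise acceptance by all would contradict farness. -/

namespace Congest

/-! ### Encoding numbers as messages -/

/-- The binary expansion of `x` as a message, provided that it fits into `B` bits. -/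
def encode (B x : ℕ) : Message B :=
  if h : x.bits.length ≤ B then ⟨x.bits, h⟩ else Message.empty B

/-- The number with the given binary expansion. -/
def decode {B : ℕ} (l : Message B) : ℕ := l.1.foldr Nat.bit 0

theorem foldr_bit_bits (x : ℕ) : x.bits.foldr Nat.bit 0 = x := by
  induction x using Nat.binaryRec' with
  | zero => simp
  | bit b n h ih => rw [Nat.bits_append_bit n b h, List.foldr_cons, ih]

theorem decode_encode {B x : ℕ} (h : x < 2 ^ B) : decode (encode B x) = x := by
  have : x.bits.length ≤ B := by rwa [Nat.size_eq_bits_len, Nat.size_le]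
  simp [encode, decode, this, foldr_bit_bits]

/-! ### Tokens

A token carries the remaining strength `m` of a center, the ID `i < K` of the center and the
distance `h ≤ R` travelled so far, packed lexicographically into one number. -/

/-- The token of strength `m` and travelled distance `h` of the center with ID `i`. -/
def token (K R m i h : ℕ) : ℕ := (m * K + i) * (R + 1) + h

/-- The ID of the center of a token. -/
def tokenId (K R x : ℕ) : ℕ := x / (R + 1) % K

/-- The distance travelled by a token. -/
def tokenDist (R x : ℕ) : ℕ := x % (R + 1)

/-- The token after one more step; `0` when its strength is used up. -/
def advance (K R x : ℕ) : ℕ := if x < K * (R + 1) then 0 else x - K * (R + 1) + 1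

theorem token_div {K R m i h : ℕ} (hh : h ≤ R) : token K R m i h / (R + 1) = m * K + i := by
  rw [token, mul_comm, Nat.mul_add_div (by omega), Nat.div_eq_of_lt (by omega), add_zero]

theorem tokenId_token {K R m i h : ℕ} (hi : i < K) (hh : h ≤ R) :
    tokenId K R (token K R m i h) = i := by
  rw [tokenId, token_div hh, mul_comm, Nat.mul_add_mod, Nat.mod_eq_of_lt hi]

theorem tokenDist_token {K R m i h : ℕ} (hh : h ≤ R) : tokenDist R (token K R m i h) = h := by
  rw [tokenDist, token, mul_comm, Nat.mul_add_mod, Nat.mod_eq_of_lt (by omega)]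

theorem advance_token_succ (K R m i h : ℕ) :
    advance K R (token K R (m + 1) i h) = token K R m i (h + 1) := by
  have : token K R (m + 1) i h = K * (R + 1) + token K R m i h := by
    simp only [token]; ring
  rw [advance, this, if_neg (by omega), Nat.add_sub_cancel_left]
  simp only [token]; omega

theorem advance_token_zero {K R i h : ℕ} (hi : i < K) (hh : h ≤ R) :
    advance K R (token K R 0 i h) = 0 := by
  have : (i + 1) * (R + 1) ≤ K * (R + 1) := Nat.mul_le_mul_right _ hi
  rw [advance, if_pos]
  simp only [token]
  nlinarith

theorem advance_mono {K R : ℕ} : Monotone (advance K R) := by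
  intro x y h
  simp only [advance]
  split_ifs <;> omega

theorem token_lt {K R m i h : ℕ} (hm : m ≤ R) (hi : i < K) (hh : h ≤ R) :
    token K R m i h < K * (R + 1) ^ 2 := by
  have h1 : m * K + i + 1 ≤ K * (R + 1) := by nlinarith
  have h2 := Nat.mul_le_mul_right (R + 1) h1
  simp only [token]
  nlinarith

/-! ### The flooding program -/

open Classical in
/-- Every processor is a center whose strength is drawn by `radius` from its coins. The strongest
token seen so far is flooded for `R` rounds; one more round compares, by means of `ok`, the cluster
ID and the depth of a processor with those of its neighbors. -/
noncomputable def floodProgram (K R B M : ℕ) (radius : (Fin M → Bool) → ℕ)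
    (ok : ℕ → ℕ × ℕ → (ℕ → ℕ × ℕ) → Prop) : Program where
  bandwidth := B
  rounds := R + 1
  coins := M
  State := ℕ × ℕ × Bool
  init i d c := (d, token K R (radius c) i 0, true)
  send s _ := encode B s.2.1
  receive s inb :=
    (s.1, max s.2.1 ((Finset.range s.1).sup fun p => advance K R (decode (inb p))),
      -- The verdict is overwritten in every round, so only the last one counts. It uses the token
      -- held before the update, which is as old as the tokens received.
      decide (ok s.1 (tokenId K R s.2.1, tokenDist R s.2.1)
        fun p => (tokenId K R (decode (inb p)), tokenDist R (decode (inb p)))))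
  output s := s.2.2

/-- `w` is the center to which `v` belongs, when centers have strengths `r` and IDs `i`. -/
def IsCenter {V : Type u} (G : SimpleGraph V) (i r : V → ℕ) (K : ℕ) (v w : V) : Prop :=
  G.Reachable v w ∧ G.dist v w ≤ r w ∧ ∀ w', G.Reachable v w' → G.dist v w' ≤ r w' →
    (r w' - G.dist v w') * K + i w' ≤ (r w - G.dist v w) * K + i w

section Flood

variable {V : Type u} {G : SimpleGraph V} (N : Network G) {K R B M : ℕ}
  {radius : (Fin M → Bool) → ℕ} {ok : ℕ → ℕ × ℕ → (ℕ → ℕ × ℕ) → Prop}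
  (ω : V → Fin M → Bool)

/-- The token held by `v` after `t` rounds. -/
noncomputable def held (K R B : ℕ) (radius : (Fin M → Bool) → ℕ)
    (ok : ℕ → ℕ × ℕ → (ℕ → ℕ × ℕ) → Prop) (ω : V → Fin M → Bool) (t : ℕ) (v : V) : ℕ :=
  ((floodProgram K R B M radius ok).run N ω t v).2.1

theorem run_fst (t : ℕ) (v : V) :
    ((floodProgram K R B M radius ok).run N ω t v).1 = N.deg v := by
  induction t with
  | zero => rfl
  | succ t ih => exact ih

theorem decode_inbox {t : ℕ} (h : ∀ u, held N K R B radius ok ω t u < 2 ^ B) (v : V) {p : ℕ}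
    (hp : p < N.deg v) :
    decode (inbox N (fun u => (floodProgram K R B M radius ok).send
      ((floodProgram K R B M radius ok).run N ω t u)) v p) =
      held N K R B radius ok ω t (N.port v ⟨p, hp⟩) := by
  rw [inbox, dif_pos hp]
  exact decode_encode (h _)

theorem held_zero (v : V) :
    held N K R B radius ok ω 0 v = token K R (radius (ω v)) (N.id v) 0 := rfl

theorem held_succ {t : ℕ} (h : ∀ u, held N K R B radius ok ω t u < 2 ^ B) (v : V) :
    held N K R B radius ok ω (t + 1) v = max (held N K R B radius ok ω t v)
      (Finset.univ.sup fun p : Fin (N.deg v) =>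
        advance K R (held N K R B radius ok ω t (N.port v p))) := by
  have h1 : held N K R B radius ok ω (t + 1) v = max (held N K R B radius ok ω t v)
      ((Finset.range ((floodProgram K R B M radius ok).run N ω t v).1).sup fun p =>
        advance K R (decode (inbox N (fun u => (floodProgram K R B M radius ok).send
          ((floodProgram K R B M radius ok).run N ω t u)) v p))) := rfl
  rw [h1, run_fst]
  congr 1
  apply le_antisymm
  · refine Finset.sup_le fun p hp => ?_
    have hp := Finset.mem_range.1 hp
    rw [decode_inbox N ω h v hp]
    exact Finset.le_sup (f := fun p : Fin (N.deg v) =>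
        advance K R (held N K R B radius ok ω t (N.port v p)))
      (Finset.mem_univ (⟨p, hp⟩ : Fin (N.deg v)))
  · refine Finset.sup_le fun p _ => ?_
    rw [← decode_inbox N ω h v p.2]
    exact Finset.le_sup (f := fun p : ℕ => advance K R (decode (inbox N (fun u =>
      (floodProgram K R B M radius ok).send
          ((floodProgram K R B M radius ok).run N ω t u)) v p))) (Finset.mem_range.2 p.2)

variable (hid : ∀ v, N.id v < K) (hr : ∀ c, radius c ≤ R) (hB : K * (R + 1) ^ 2 ≤ 2 ^ B)
include hid hr hB

/-- Kept separate so that the induction below can discharge the no-overflow hypothesis of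
`held_succ` from its own hypothesis. -/
theorem held_lt_of_walk {t : ℕ} {v : V}
    (h : ∃ (w : V) (q : G.Walk v w), q.length ≤ radius (ω w) ∧ held N K R B radius ok ω t v =
      token K R (radius (ω w) - q.length) (N.id w) q.length) :
    held N K R B radius ok ω t v < 2 ^ B := by
  obtain ⟨w, q, h1, h2⟩ := h
  have := hr (ω w)
  rw [h2]
  exact (token_lt (by omega) (hid w) (by omega)).trans_le hB

theorem held_eq_token (t : ℕ) (v : V) :
    ∃ (w : V) (q : G.Walk v w), q.length ≤ radius (ω w) ∧ held N K R B radius ok ω t v =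
      token K R (radius (ω w) - q.length) (N.id w) q.length := by
  induction t generalizing v with
  | zero => exact ⟨v, .nil, by simp [held_zero]⟩
  | succ t ih =>
    rw [held_succ N ω (fun u => held_lt_of_walk N ω hid hr hB (ih u))]
    set s := Finset.univ.sup fun p : Fin (N.deg v) =>
        advance K R (held N K R B radius ok ω t (N.port v p)) with hs
    rcases le_or_gt s (held N K R B radius ok ω t v) with h | h
    · rw [max_eq_left h]; exact ih v
    · rw [max_eq_right h.le]
      have hne : (Finset.univ : Finset (Fin (N.deg v))).Nonempty := by
        by_contra hne
        rw [Finset.not_nonempty_iff_eq_empty] at hne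
        simp [hs, hne] at h
      obtain ⟨p, -, hp⟩ := Finset.exists_mem_eq_sup _ hne fun p : Fin (N.deg v) =>
        advance K R (held N K R B radius ok ω t (N.port v p))
      obtain ⟨w, q, h1, h2⟩ := ih (N.port v p)
      have hR := hr (ω w)
      rw [← hs, h2] at hp
      -- A token with no strength left advances to `0`, which cannot strictly exceed the held value.
      obtain ⟨m, hm⟩ : ∃ m, radius (ω w) - q.length = m + 1 := by
        rcases Nat.eq_zero_or_pos (radius (ω w) - q.length) with h0 | h0
        · rw [h0, advance_token_zero (hid w) (by omega)] at hp
          omega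
        · exact ⟨_, (Nat.sub_add_cancel h0).symm⟩
      have hadj : G.Adj v (N.port v p) := (N.port v p).2
      refine ⟨w, .cons hadj q, ?_, ?_⟩
      · rw [SimpleGraph.Walk.length_cons]; omega
      · rw [hp, hm, advance_token_succ, SimpleGraph.Walk.length_cons]
        congr 1; omega

theorem held_lt (t : ℕ) (v : V) : held N K R B radius ok ω t v < 2 ^ B :=
  held_lt_of_walk N ω hid hr hB (held_eq_token N ω hid hr hB t v)

/-- A processor on the walk may forward another token instead, but only a larger one, and `advance`
is monotone. -/
theorem token_le_held {t : ℕ} {v w : V} (q : G.Walk v w) (hq : q.length ≤ t)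
    (hqr : q.length ≤ radius (ω w)) :
    token K R (radius (ω w) - q.length) (N.id w) q.length ≤ held N K R B radius ok ω t v := by
  induction t generalizing v with
  | zero =>
    cases q with
    | nil => simp [held_zero]
    | cons _ _ => simp at hq
  | succ t ih =>
    rw [held_succ N ω (held_lt N ω hid hr hB t)]
    cases q with
    | nil => exact le_max_of_le_left (ih .nil (by simp) (by simp))
    | @cons _ u _ h q =>
      rw [SimpleGraph.Walk.length_cons] at *
      refine le_max_of_le_right ?_
      have h1 := advance_mono (K := K) (R := R) (ih q (by omega) (by omega))
      obtain ⟨m, hm⟩ : ∃ m, radius (ω w) - q.length = m + 1 :=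
        ⟨radius (ω w) - q.length - 1, by omega⟩
      rw [hm, advance_token_succ] at h1
      have h2 : radius (ω w) - (q.length + 1) = m := by omega
      rw [h2]
      refine h1.trans ?_
      have h3 := Finset.le_sup (f := fun p : Fin (N.deg v) =>
        advance K R (held N K R B radius ok ω t (N.port v p)))
        (Finset.mem_univ ((N.port v).symm ⟨u, h⟩))
      simpa using h3

/-- After `R` rounds every processor knows the ID of its center and its distance from it. -/
theorem exists_isCenter (v : V) :
    ∃ w, IsCenter G N.id (fun w => radius (ω w)) K v w ∧
      tokenId K R (held N K R B radius ok ω R v) = N.id w ∧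
      tokenDist R (held N K R B radius ok ω R v) = G.dist v w := by
  obtain ⟨w, q, h1, h2⟩ := held_eq_token (ok := ok) N ω hid hr hB R v
  have hR := hr (ω w)
  have key : ∀ w', G.Reachable v w' → G.dist v w' ≤ radius (ω w') →
      (radius (ω w') - G.dist v w') * K + N.id w' ≤
        (radius (ω w) - q.length) * K + N.id w := by
    intro w' hw' hd
    obtain ⟨q', hq'⟩ := hw'.exists_walk_length_eq_dist
    have hR' := hr (ω w')
    have h3 := token_le_held (ok := ok) N ω hid hr hB (t := R) q' (by omega) (by omega)
    rw [h2, hq'] at h3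
    have h4 := Nat.div_le_div_right (c := R + 1) h3
    rwa [token_div (by omega), token_div (by omega)] at h4
  have hle : G.dist v w ≤ q.length := SimpleGraph.dist_le q
  -- A shorter walk to the same center would leave more strength, hence a larger token.
  have hlen : q.length = G.dist v w := by
    have h3 := key w ⟨q⟩ (by omega)
    have hK : 0 < K := (Nat.zero_le _).trans_lt (hid w)
    have h4 := Nat.le_of_mul_le_mul_right (Nat.le_of_add_le_add_right h3) hK
    omega
  rw [hlen] at key h2
  refine ⟨w, ⟨⟨q⟩, hle.trans h1, key⟩, ?_, ?_⟩
  · rw [h2, tokenId_token (hid w) (by omega)]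
  · rw [h2, tokenDist_token (by omega)]

/-- The verdicts of the flooding program. -/
theorem result_eq_true_iff (hok : ∀ d x y y', (∀ p < d, y p = y' p) → ok d x y → ok d x y')
    (v : V) {y : ℕ → ℕ × ℕ}
    (hy : ∀ p (hp : p < N.deg v), y p =
      (tokenId K R (held N K R B radius ok ω R (N.port v ⟨p, hp⟩)),
        tokenDist R (held N K R B radius ok ω R (N.port v ⟨p, hp⟩)))) :
    (floodProgram K R B M radius ok).result N ω v = true ↔
      ok (N.deg v) (tokenId K R (held N K R B radius ok ω R v),
        tokenDist R (held N K R B radius ok ω R v)) y := by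
  have h0 : (floodProgram K R B M radius ok).result N ω v = true ↔
      ok ((floodProgram K R B M radius ok).run N ω R v).1
        (tokenId K R (held N K R B radius ok ω R v),
        tokenDist R (held N K R B radius ok ω R v)) (fun p =>
        (tokenId K R (decode (inbox N (fun u => (floodProgram K R B M radius ok).send
          ((floodProgram K R B M radius ok).run N ω R u)) v p)),
         tokenDist R (decode (inbox N (fun u => (floodProgram K R B M radius ok).send
          ((floodProgram K R B M radius ok).run N ω R u)) v p)))) := by
    classical exact decide_eq_true_iff
  rw [h0, run_fst]
  have hlt := held_lt (ok := ok) N ω hid hr hB R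
  constructor <;> refine hok _ _ _ _ fun p hp => ?_
  · rw [hy p hp, decode_inbox N ω hlt v hp]
  · rw [hy p hp, decode_inbox N ω hlt v hp]

end Flood


open Finset

/-! ### Truncated geometric strengths -/

open Classical in
/-- `r` is at most `R`, its conditional probability of going one step further is at least `q`, and
the probability of reaching `R` is at most `η`. -/
structure IsGeometric {Ω : Type*} [Fintype Ω] (r : Ω → ℕ) (R : ℕ) (q η : ℝ) : Prop where
  le : ∀ c, r c ≤ R
  step : ∀ d < R, q * (#{c | d ≤ r c} : ℝ) ≤ #{c | d + 1 ≤ r c}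
  tail : (#{c | R ≤ r c} : ℝ) ≤ η * Fintype.card Ω

open Classical in
-- Memorylessness: an upward closed condition is a threshold `d ≤ r c`. Below `R` the field `step`
-- applies; from `R` on, the event lies in the tail and is paid for by `η`.
theorem IsGeometric.shift {Ω : Type*} [Fintype Ω] {r : Ω → ℕ} {R : ℕ} {q η : ℝ}
    (h : IsGeometric r R q η) (hq : q ≤ 1) {P : ℤ → Prop}
    (hP : ∀ a b, a ≤ b → P a → P b) :
    q * (#{c | P (r c)} : ℝ) ≤ #{c | P (r c - 1)} + η * Fintype.card Ω := by
  have h0 : (0 : ℝ) ≤ η * Fintype.card Ω := le_trans (by positivity) h.tail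
  by_cases hex : ∃ d : ℕ, P d
  · have hd := Nat.find_spec hex
    set d := Nat.find hex
    have hiff : ∀ c, P (r c) ↔ d ≤ r c := fun c =>
      ⟨fun hc => Nat.find_min' hex hc, fun hc => hP _ _ (by exact_mod_cast hc) hd⟩
    simp only [hiff]
    rcases lt_or_ge d R with hdR | hdR
    · refine (h.step d hdR).trans ?_
      have : (#{c | d + 1 ≤ r c} : ℝ) ≤ #{c | P (r c - 1)} := by
        refine Nat.cast_le.2 (card_le_card (monotone_filter_right _ fun c _ hc => ?_))
        exact hP _ _ (le_sub_iff_add_le.2 (by exact_mod_cast hc)) hd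
      linarith
    · have h1 : (#{c | d ≤ r c} : ℝ) ≤ #{c | R ≤ r c} := by
        exact_mod_cast card_le_card (monotone_filter_right _ fun c _ hc => hdR.trans hc)
      have h2 : q * (#{c | d ≤ r c} : ℝ) ≤ 1 * #{c | d ≤ r c} :=
        mul_le_mul_of_nonneg_right hq (by positivity)
      have h3 : (0 : ℝ) ≤ #{c | P (r c - 1)} := by positivity
      linarith [h.tail]
  · push Not at hex
    simp only [hex, filter_false, card_empty, Nat.cast_zero, mul_zero]
    positivity

open Classical in
theorem card_filter_pi_eq_sum {V : Type u} {Ω : Type*} [Fintype V] [Fintype Ω] (w : V)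
    (S : ({j // j ≠ w} → Ω) → Ω → Prop) :
    #{ω : V → Ω | S (fun j => ω j) (ω w)} = ∑ o, #{c | S o c} := by
  simp only [card_filter]
  rw [← Fintype.sum_prod_type_right (fun x : Ω × ({j // j ≠ w} → Ω) => if S x.2 x.1 then 1 else 0),
    ← (Equiv.funSplitAt w Ω).sum_comp]
  simp

/-- The center `w` beats every other one by more than `s` steps, where `f` measures distances. -/
def Leads {V : Type u} (i r f : V → ℕ) (K : ℕ) (s : ℤ) (w : V) : Prop :=
  ∀ w', w' ≠ w → (K : ℤ) * (r w' - f w') + i w' < K * (r w - f w - s) + i w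

open Classical in
theorem IsGeometric.shift_pi {V : Type u} {Ω : Type*} [Fintype V] [Fintype Ω] {r : Ω → ℕ} {R : ℕ}
    {q η : ℝ} (h : IsGeometric r R q η) (hq : q ≤ 1) (w : V) {P : ({j // j ≠ w} → Ω) → ℤ → Prop}
    (hP : ∀ o a b, a ≤ b → P o a → P o b) :
    q * (#{ω : V → Ω | P (fun j => ω j) (r (ω w))} : ℝ) ≤
      #{ω : V → Ω | P (fun j => ω j) (r (ω w) - 1)} + η * Fintype.card (V → Ω) := by
  have e2 : Fintype.card (V → Ω) = Fintype.card Ω * Fintype.card ({j // j ≠ w} → Ω) := by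
    rw [Fintype.card_congr (Equiv.funSplitAt w Ω), Fintype.card_prod]
  rw [card_filter_pi_eq_sum w (fun o c => P o (r c)),
    card_filter_pi_eq_sum w (fun o c => P o (r c - 1)), e2]
  push_cast
  calc _ = ∑ o, q * (#{c | P o (r c)} : ℝ) := mul_sum _ _ _
    _ ≤ ∑ o, ((#{c | P o (r c - 1)} : ℝ) + η * Fintype.card Ω) :=
      sum_le_sum fun o _ => h.shift hq (hP o)
    _ = _ := by
      rw [sum_add_distrib, sum_const, nsmul_eq_mul, card_univ]; ring

open Classical in
-- Leading by one more step is leading with own strength lowered by one, so `shift_pi` applies with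
-- the other strengths fixed.
theorem IsGeometric.card_leads {V : Type u} {Ω : Type*} [Fintype V] [Fintype Ω] {r : Ω → ℕ} {R : ℕ}
    {q η : ℝ} (h : IsGeometric r R q η) (hq : q ≤ 1) (i f : V → ℕ) (K : ℕ) (w : V) :
    q * (#{ω : V → Ω | Leads i (fun v => r (ω v)) f K 0 w} : ℝ) ≤
      #{ω : V → Ω | Leads i (fun v => r (ω v)) f K 1 w} + η * Fintype.card (V → Ω) := by
  obtain ⟨P, hP⟩ : ∃ P : ({j // j ≠ w} → Ω) → ℤ → Prop, ∀ o a, P o a ↔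
      ∀ w' : {j // j ≠ w}, (K : ℤ) * (r (o w') - f w') + i w' < K * (a - f w) + i w :=
    ⟨_, fun _ _ => Iff.rfl⟩
  have e0 : ∀ ω : V → Ω, Leads i (fun v => r (ω v)) f K 0 w ↔ P (fun j => ω j) (r (ω w)) := by
    simp [Leads, hP]
  have e1 : ∀ ω : V → Ω,
      Leads i (fun v => r (ω v)) f K 1 w ↔ P (fun j => ω j) (r (ω w) - 1) := by
    simp [Leads, hP, sub_right_comm]
  simp only [e0, e1]
  refine h.shift_pi hq w fun o a b hab ha => ?_
  rw [hP] at ha ⊢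
  exact fun w' => (ha w').trans_le (by gcongr)

theorem exists_leads {V : Type u} [Fintype V] [Nonempty V] {i : V → ℕ} (hi : Function.Injective i)
    {K : ℕ} (hK : ∀ v, i v < K) (r f : V → ℕ) : ∃ w, Leads i r f K 0 w := by
  obtain ⟨w, -, hw⟩ := exists_max_image univ (fun w => (K : ℤ) * (r w - f w) + i w) univ_nonempty
  refine ⟨w, fun w' hne => lt_of_le_of_ne ?_ ?_⟩
  · simpa using hw w' (mem_univ _)
  · intro heq
    -- Scores are congruent to IDs modulo `K`, so distinct centers never tie.
    have h1 := congrArg (· % (K : ℤ)) heq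
    simp only [Int.mul_add_emod_self_left] at h1
    rw [Int.emod_eq_of_lt (by positivity) (by exact_mod_cast hK _),
      Int.emod_eq_of_lt (by positivity) (by exact_mod_cast hK _)] at h1
    exact hne (hi (by exact_mod_cast h1))

theorem Leads.unique {V : Type u} {i r f : V → ℕ} {K : ℕ} {w w' : V}
    (h : Leads i r f K 1 w) (h' : Leads i r f K 1 w') : w = w' := by
  by_contra hne
  have h1 := h w' (Ne.symm hne)
  have h2 := h' w hne
  have : (0 : ℤ) ≤ K := by positivity
  linarith

open Classical in
/-- With probability at least `q - |V| η` some center leads by more than one step. -/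
theorem IsGeometric.card_exists_leads {V : Type u} {Ω : Type*} [Fintype V] [Nonempty V] [Fintype Ω]
    {r : Ω → ℕ} {R : ℕ} {q η : ℝ} (h : IsGeometric r R q η) (hq0 : 0 ≤ q) (hq : q ≤ 1)
    {i : V → ℕ} (hi : Function.Injective i) {K : ℕ} (hK : ∀ v, i v < K) (f : V → ℕ) :
    (q - Fintype.card V * η) * Fintype.card (V → Ω) ≤
      #{ω : V → Ω | ∃ w, Leads i (fun v => r (ω v)) f K 1 w} := by
  -- The events of leading by `0` cover the sample space, while those of leading by `1` are
  -- disjoint; summing `card_leads` over all centers compares the two.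
  have h1 : Fintype.card (V → Ω) ≤ ∑ w, #{ω : V → Ω | Leads i (fun v => r (ω v)) f K 0 w} := by
    refine le_trans ?_ card_biUnion_le
    rw [← card_univ]
    refine card_le_card fun ω _ => ?_
    simpa using exists_leads hi hK (fun v => r (ω v)) f
  have h2 : ∑ w, #{ω : V → Ω | Leads i (fun v => r (ω v)) f K 1 w} =
      #{ω : V → Ω | ∃ w, Leads i (fun v => r (ω v)) f K 1 w} := by
    rw [← card_biUnion]
    · congr 1; ext ω; simp
    · intro w _ w' _ hne
      refine disjoint_left.2 fun ω hω hω' => hne ?_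
      exact (mem_filter.1 hω).2.unique (mem_filter.1 hω').2
  have h3 := sum_le_sum fun w (_ : w ∈ univ) => h.card_leads (V := V) hq i f K w
  rw [← mul_sum, sum_add_distrib, sum_const, card_univ, nsmul_eq_mul] at h3
  have h4 : (Fintype.card (V → Ω) : ℝ) ≤
      ∑ w, (#{ω : V → Ω | Leads i (fun v => r (ω v)) f K 0 w} : ℝ) := by exact_mod_cast h1
  have h5 := mul_le_mul_of_nonneg_left h4 hq0
  rw [← h2]
  push_cast
  linarith

open Classical in
/-- The Markov inequality for the number of elements of `E` that are bad. -/
theorem card_filter_mul_le {Ω ι : Type*} [Fintype Ω] (E : Finset ι) (bad : Ω → ι → Prop) {δ : ℝ}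
    (h : ∀ e ∈ E, (#{ω | bad ω e} : ℝ) ≤ δ * Fintype.card Ω) (a : ℝ) :
    a * #{ω | a ≤ #{e ∈ E | bad ω e}} ≤ δ * #E * Fintype.card Ω := by
  have h1 : ∑ ω, (#{e ∈ E | bad ω e} : ℝ) = ∑ e ∈ E, (#{ω | bad ω e} : ℝ) := by
    simp only [card_filter, Nat.cast_sum]
    exact sum_comm
  calc a * #{ω | a ≤ #{e ∈ E | bad ω e}}
      = ∑ ω with a ≤ #{e ∈ E | bad ω e}, a := by rw [sum_const, nsmul_eq_mul, mul_comm]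
    _ ≤ ∑ ω with a ≤ #{e ∈ E | bad ω e}, (#{e ∈ E | bad ω e} : ℝ) :=
      sum_le_sum fun ω hω => (mem_filter.1 hω).2
    _ ≤ ∑ ω, (#{e ∈ E | bad ω e} : ℝ) :=
      sum_le_sum_of_subset_of_nonneg (filter_subset _ _) fun _ _ _ => by positivity
    _ ≤ ∑ e ∈ E, δ * Fintype.card Ω := h1 ▸ sum_le_sum h
    _ = _ := by rw [sum_const, nsmul_eq_mul]; ring

/-! ### Drawing strengths from fair coins -/

open Classical in
/-- The number of leading blocks, out of `R` blocks of `j` coins each, in which not all coins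
show `false`. -/
noncomputable def blockRadius (R j : ℕ) (c : Fin (R * j) → Bool) : ℕ :=
  Nat.findGreatest (fun d => ∀ a : Fin R, a < d → ∃ b : Fin j, c (finProdFinEquiv (a, b)) = true) R

theorem le_blockRadius_iff {R j d : ℕ} (hd : d ≤ R) (c : Fin (R * j) → Bool) :
    d ≤ blockRadius R j c ↔
      ∀ a : Fin R, a < d → ∃ b : Fin j, c (finProdFinEquiv (a, b)) = true := by
  classical
  constructor
  · intro h a ha
    refine Nat.findGreatest_spec (P := fun d => ∀ a : Fin R, a < d →
      ∃ b : Fin j, c (finProdFinEquiv (a, b)) = true) (Nat.zero_le R) (by simp) a ?_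
    exact lt_of_lt_of_le ha h
  · intro h
    exact Nat.le_findGreatest hd h

open Classical in
-- Each of the first `d` blocks avoids only the all-`false` pattern; the other blocks are free.
theorem card_le_blockRadius {R j d : ℕ} (hd : d ≤ R) :
    #{c | d ≤ blockRadius R j c} = (2 ^ j - 1) ^ d * (2 ^ j) ^ (R - d) := by
  have h1 : #{c | d ≤ blockRadius R j c} =
      #(Fintype.piFinset fun a : Fin R =>
        if a < d then ({fun _ => false}ᶜ : Finset (Fin j → Bool)) else univ) := by
    refine card_equiv ((Equiv.arrowCongr finProdFinEquiv.symm (Equiv.refl Bool)).trans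
      (Equiv.curry _ _ _)) fun c => ?_
    rw [mem_filter, le_blockRadius_iff hd, Fintype.mem_piFinset]
    simp only [mem_univ, true_and]
    refine forall_congr' fun a => ?_
    split_ifs with ha
    · simp [ha, funext_iff]
    · simp [ha]
  rw [h1, Fintype.card_piFinset]
  have h2 : ∀ a : Fin R, #(if (a : ℕ) < d then ({fun _ => false}ᶜ : Finset (Fin j → Bool)) else univ)
      = if (a : ℕ) < d then 2 ^ j - 1 else 2 ^ j := by
    intro a
    split_ifs
    · simp [card_compl]
    · simp
  simp only [h2]
  rw [Fin.prod_univ_eq_prod_range (fun a => if a < d then 2 ^ j - 1 else 2 ^ j) R,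
    ← Nat.add_sub_cancel' hd, prod_range_add]
  congr 1
  · rw [prod_congr rfl fun a ha => if_pos (mem_range.1 ha), prod_const, card_range]
  · simp

theorem isGeometric_blockRadius (R j : ℕ) :
    IsGeometric (blockRadius R j) R (1 - 1 / 2 ^ j) ((1 - 1 / 2 ^ j) ^ R) := by
  have hpos : (0 : ℝ) < 2 ^ j := by positivity
  have hcast : ((2 ^ j - 1 : ℕ) : ℝ) = 2 ^ j * (1 - 1 / 2 ^ j) := by
    rw [Nat.cast_sub Nat.one_le_two_pow]
    field_simp
    push_cast; ring
  refine ⟨fun c => Nat.findGreatest_le R, fun d hd => ?_, ?_⟩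
  · rw [card_le_blockRadius hd.le, card_le_blockRadius (d := d + 1) hd]
    obtain ⟨m, rfl⟩ : ∃ m, R = d + 1 + m := ⟨R - (d + 1), by omega⟩
    rw [Nat.add_sub_cancel_left, add_assoc d 1 m, Nat.add_sub_cancel_left]
    push_cast [hcast]
    generalize (1 - 1 / 2 ^ j : ℝ) = q
    apply le_of_eq
    ring
  · rw [card_le_blockRadius le_rfl]
    push_cast [hcast, Fintype.card_fun, Fintype.card_fin, Fintype.card_bool]
    rw [Nat.sub_self, pow_zero, mul_one, mul_pow, ← pow_mul, mul_comm j R, mul_comm]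


/-! ### Clusters -/

/-- The edges of `G` between vertices with the same label. -/
def clusterGraph {V : Type u} (G : SimpleGraph V) (a : V → ℕ) : SimpleGraph V where
  Adj u v := G.Adj u v ∧ a u = a v
  symm := ⟨fun _ _ h => ⟨h.1.symm, h.2.symm⟩⟩
  loopless := ⟨fun _ h => h.1.ne rfl⟩

theorem IsCenter.id_eq {V : Type u} {G : SimpleGraph V} {i r : V → ℕ} {K : ℕ}
    (hK : ∀ v, i v < K) {v w w' : V} (h : IsCenter G i r K v w) (h' : IsCenter G i r K v w') :
    i w = i w' := by
  have heq := le_antisymm (h'.2.2 w h.1 h.2.1) (h.2.2 w' h'.1 h'.2.1)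
  have h1 := congrArg (· % K) heq
  simpa [Nat.mul_add_mod_of_lt, Nat.mod_eq_of_lt (hK _)] using h1

/-- A center that leads by more than one step with respect to distances that are exact up to one
step is the center of `v`. -/
theorem Leads.isCenter {V : Type u} {G : SimpleGraph V} {i r f : V → ℕ} {K R : ℕ}
    (hK : ∀ v, i v < K) (hr : ∀ v, r v ≤ R) {v w : V} (hfv : f v = 0)
    (hf : ∀ w', G.Reachable v w' → f w' ≤ G.dist v w' ∧ G.dist v w' ≤ f w' + 1)
    (hf' : ∀ w', ¬ G.Reachable v w' → R < f w') (h : Leads i r f K 1 w) :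
    IsCenter G i r K v w := by
  have hKw : (i w : ℤ) < K := by exact_mod_cast hK w
  have hK0 : (0 : ℤ) < K := by omega
  -- The score of `v` itself is nonnegative, so beating it by more than one step leaves `w` a spare
  -- step. It pays for the error in `f` and excludes other components, where `f` exceeds `R`.
  have hkey : w ≠ v → f w + 1 ≤ r w := by
    intro hne
    have h1 := h v hne.symm
    rw [hfv] at h1
    by_contra hlt
    have h2 : ((r w : ℤ) - f w - 1) ≤ -1 := by omega
    have h3 := mul_le_mul_of_nonneg_left h2 hK0.le
    have h4 : (0 : ℤ) ≤ K * (r v - (0 : ℕ)) + i v := by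
      have : (0 : ℤ) ≤ K * r v := by positivity
      push_cast
      rw [sub_zero]
      positivity
    linarith
  have hreach : G.Reachable v w := by
    by_contra hn
    have hne : w ≠ v := by rintro rfl; exact hn (.refl _)
    have := hkey hne
    have := hf' w hn
    have := hr w
    omega
  have hdist : G.dist v w ≤ r w := by
    by_cases hne : w = v
    · subst hne; simp
    · exact (hf w hreach).2.trans (hkey hne)
  refine ⟨hreach, hdist, fun w' hw' hd' => ?_⟩
  by_cases hne : w' = w
  · rw [hne]
  have h1 := h w' hne
  have h2 : (K : ℤ) * (r w' - G.dist v w') ≤ K * (r w' - f w') :=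
    mul_le_mul_of_nonneg_left (by have := (hf w' hw').1; omega) hK0.le
  have h3 : (K : ℤ) * (r w - f w - 1) ≤ K * (r w - G.dist v w) :=
    mul_le_mul_of_nonneg_left (by have := (hf w hreach).2; omega) hK0.le
  zify [hd', hdist]
  linarith

theorem dist_le_succ_of_adj {V : Type u} {G : SimpleGraph V} {u v w : V} (h : G.Adj u v)
    (hw : G.Reachable v w) : G.dist u w ≤ G.dist v w + 1 := by
  obtain ⟨q, hq⟩ := hw.exists_walk_length_eq_dist
  simpa [hq] using SimpleGraph.dist_le (SimpleGraph.Walk.cons h q)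

open Classical in
/-- The distance from the edge `uv`, and `R + 1` in the other components. -/
noncomputable def edgeDist {V : Type u} (G : SimpleGraph V) (R : ℕ) (u v w : V) : ℕ :=
  if G.Reachable u w then min (G.dist u w) (G.dist v w) else R + 1

theorem Leads.isCenter_of_adj {V : Type u} {G : SimpleGraph V} {i r : V → ℕ} {K R : ℕ}
    (hK : ∀ v, i v < K) (hr : ∀ v, r v ≤ R) {u v w : V} (huv : G.Adj u v)
    (h : Leads i r (edgeDist G R u v) K 1 w) :
    IsCenter G i r K u w ∧ IsCenter G i r K v w := by
  have hiff : ∀ x, G.Reachable v x ↔ G.Reachable u x := fun x =>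
    ⟨fun hx => huv.reachable.trans hx, fun hx => huv.symm.reachable.trans hx⟩
  constructor
  · refine h.isCenter hK hr (by simp [edgeDist]) (fun x hx => ?_) (fun x hx => ?_)
    · have := dist_le_succ_of_adj huv ((hiff x).2 hx)
      simp only [edgeDist, hx, if_true]
      omega
    · simp [edgeDist, hx]
  · refine h.isCenter hK hr (by simp [edgeDist, huv.reachable]) (fun x hx => ?_) (fun x hx => ?_)
    · have hx' := (hiff x).1 hx
      have := dist_le_succ_of_adj huv.symm hx'
      simp only [edgeDist, hx', if_true]
      omega
    · rw [hiff] at hx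
      simp [edgeDist, hx]

/-! ### Local verification -/

/-- A condition `ok`, on the degree of a processor, its cluster ID and depth and those of its
neighbors, is a local certificate for `P` in clusters of breadth-first-search trees. -/
structure IsCertificate (P : ∀ V : Type u, SimpleGraph V → Prop)
    (ok : ℕ → ℕ × ℕ → (ℕ → ℕ × ℕ) → Prop) : Prop where
  bot : ∀ V, P V ⊥
  congr : ∀ d x y y', (∀ p < d, y p = y' p) → ok d x y → ok d x y'
  sound : ∀ (V : Type u) (G : SimpleGraph V) (N : Network G) (z : V → V),
    P V G → (∀ v, G.Reachable v (z v)) → ∀ (v : V) (y : ℕ → ℕ × ℕ),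
      (∀ p (hp : p < N.deg v), y p =
        (N.id (z (N.port v ⟨p, hp⟩)), G.dist (N.port v ⟨p, hp⟩) (z (N.port v ⟨p, hp⟩)))) →
      ok (N.deg v) (N.id (z v), G.dist v (z v)) y
  complete : ∀ (V : Type u) (G : SimpleGraph V) (N : Network G) (x : V → ℕ × ℕ)
    (y : V → ℕ → ℕ × ℕ), (∀ v p (hp : p < N.deg v), y v p = x (N.port v ⟨p, hp⟩)) →
      (∀ v, ok (N.deg v) (x v) (y v)) → P V (clusterGraph G fun v => (x v).1)

/-- In a cluster, depths of adjacent vertices have different parities. -/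
def BipartiteOk (d : ℕ) (x : ℕ × ℕ) (y : ℕ → ℕ × ℕ) : Prop :=
  ∀ p < d, x.1 = (y p).1 → x.2 % 2 ≠ (y p).2 % 2

/-- In a cluster, depths of adjacent vertices differ, and a vertex has at most one neighbor of
smaller depth. -/
def AcyclicOk (d : ℕ) (x : ℕ × ℕ) (y : ℕ → ℕ × ℕ) : Prop :=
  ∀ p < d, x.1 = (y p).1 → x.2 ≠ (y p).2 ∧
    ∀ p' < d, x.1 = (y p').1 → (y p).2 < x.2 → (y p').2 < x.2 → p = p'

theorem port_adj {V : Type u} {G : SimpleGraph V} (N : Network G) (v : V) (p : Fin (N.deg v)) :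
    G.Adj v (N.port v p) := (N.port v p).2

theorem exists_port {V : Type u} {G : SimpleGraph V} (N : Network G) {v u : V} (h : G.Adj v u) :
    ∃ (p : ℕ) (hp : p < N.deg v), (N.port v ⟨p, hp⟩ : V) = u :=
  ⟨(N.port v).symm ⟨u, h⟩, Fin.is_lt _, by simp⟩

theorem isCertificate_bipartiteOk :
    IsCertificate.{u} (fun _ G => G.IsBipartite) BipartiteOk where
  bot V := ⟨SimpleGraph.Coloring.mk (fun _ => 0) (fun h => h.elim)⟩
  congr d x y y' h hy p hp := by rw [← h p hp]; exact hy p hp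
  sound V G N z hG hz v y hy p hp := by
    rw [hy p hp]
    intro hid hmod
    obtain ⟨c'⟩ := hG
    have c : G.Coloring Bool := SimpleGraph.recolorOfEquiv G finTwoEquiv c'
    have hadj := port_adj N v ⟨p, hp⟩
    set u : V := (N.port v ⟨p, hp⟩).1
    have hzz : z v = z u := N.id_injective hid
    obtain ⟨q, hq⟩ := (hz v).exists_walk_length_eq_dist
    obtain ⟨q', hq'⟩ := (hz u).exists_walk_length_eq_dist
    -- In a 2-colored graph the parity of the distance to the common center determines the color.
    have h1 := c.even_length_iff_congr q
    have h2 := c.even_length_iff_congr q'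
    have h3 := c.valid hadj
    rw [hq, hzz] at h1
    rw [hq'] at h2
    simp only [hzz] at hmod
    have h4 : Even (G.dist v (z u)) ↔ Even (G.dist u (z u)) := by
      rw [Nat.even_iff, Nat.even_iff, hmod]
    rw [h1, h2] at h4
    revert h3 h4
    cases c v <;> cases c u <;> cases c (z u) <;> simp
  complete V G N x y hy hok := by
    refine ⟨SimpleGraph.Coloring.mk (fun v => ⟨(x v).2 % 2, Nat.mod_lt _ two_pos⟩) ?_⟩
    rintro v u ⟨hadj, hvu⟩ heq
    obtain ⟨p, hp, rfl⟩ := exists_port N hadj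
    have h1 := hok v p hp
    rw [hy v p hp] at h1
    exact h1 hvu (by simpa using heq)

/-- A graph is acyclic if its vertices have depths such that adjacent ones differ in depth and each
vertex has at most one neighbor of smaller depth. -/
theorem isAcyclic_of_depth {V : Type u} {G : SimpleGraph V} (b : V → ℕ)
    (h1 : ∀ u v, G.Adj u v → b u ≠ b v)
    (h2 : ∀ v u u', G.Adj v u → G.Adj v u' → b u < b v → b u' < b v → u = u') :
    G.IsAcyclic := by
  classical
  intro v c hc
  -- Both cycle neighbors of a deepest vertex are shallower, hence equal, which a cycle forbids.
  obtain ⟨w, hw, hmax⟩ := exists_max_image c.support.toFinset b ⟨v, by simp⟩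
  rw [List.mem_toFinset] at hw
  have hc' := hc.rotate hw
  have hlow : ∀ u ∈ (c.rotate w hw).support, G.Adj w u → b u < b w := fun u hu hadj =>
    lt_of_le_of_ne (hmax u (by rwa [List.mem_toFinset, ← c.mem_support_rotate_iff w hw]))
      (h1 w u hadj).symm
  have ha := SimpleGraph.Walk.adj_snd hc'.not_nil
  have ha' := (SimpleGraph.Walk.adj_penultimate hc'.not_nil).symm
  exact hc'.snd_ne_penultimate (h2 w _ _ ha ha'
    (hlow _ (SimpleGraph.Walk.getVert_mem_support _ _) ha)
    (hlow _ (SimpleGraph.Walk.getVert_mem_support _ _) ha'))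

/-- A geodesic from `u` to `w` through `v` would make `v` strictly closer to `w` than `u`. -/
theorem exists_isPath_cons {V : Type u} {G : SimpleGraph V} {u v w : V} (h : G.Adj v u)
    (hu : G.Reachable u w) (hd : G.dist u w ≤ G.dist v w) :
    ∃ q : G.Walk u w, q.length = G.dist u w ∧ (SimpleGraph.Walk.cons h q).IsPath := by
  classical
  obtain ⟨q, hq, hql⟩ := hu.exists_path_of_dist
  refine ⟨q, hql, hq.cons fun hv => ?_⟩
  have h1 := SimpleGraph.dist_le (q.dropUntil v hv)
  have h2 : 0 < (q.takeUntil v hv).length := by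
    rw [Nat.pos_iff_ne_zero]
    exact fun h0 => h.ne (SimpleGraph.Walk.eq_of_length_eq_zero h0).symm
  have h3 := congrArg SimpleGraph.Walk.length (q.take_spec hv)
  rw [SimpleGraph.Walk.length_append] at h3
  omega

/-- With equal distances, the path through `u` would be one longer than a geodesic from `v`, against
uniqueness of paths. -/
theorem dist_ne_of_adj_of_isAcyclic {V : Type u} {G : SimpleGraph V} (hG : G.IsAcyclic)
    {u v w : V} (h : G.Adj v u) (hv : G.Reachable v w) (hu : G.Reachable u w) :
    G.dist v w ≠ G.dist u w := by
  intro heq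
  obtain ⟨q, hql, hq⟩ := exists_isPath_cons h hu heq.ge
  obtain ⟨q', hq', hql'⟩ := hv.exists_path_of_dist
  have h1 := congrArg (fun p : G.Path v w => p.1.length)
    ((hG.subsingleton_path v w).elim ⟨_, hq⟩ ⟨_, hq'⟩)
  simp only [SimpleGraph.Walk.length_cons] at h1
  omega

theorem eq_of_adj_of_isAcyclic {V : Type u} {G : SimpleGraph V} (hG : G.IsAcyclic)
    {u u' v w : V} (h : G.Adj v u) (h' : G.Adj v u') (hu : G.Reachable u w)
    (hu' : G.Reachable u' w) (hd : G.dist u w ≤ G.dist v w) (hd' : G.dist u' w ≤ G.dist v w) :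
    u = u' := by
  obtain ⟨q, -, hq⟩ := exists_isPath_cons h hu hd
  obtain ⟨q', -, hq'⟩ := exists_isPath_cons h' hu' hd'
  have h1 := congrArg (fun p : G.Path v w => p.1.snd)
    ((hG.subsingleton_path v w).elim ⟨_, hq⟩ ⟨_, hq'⟩)
  simpa using h1

theorem isCertificate_acyclicOk :
    IsCertificate.{u} (fun _ G => G.IsAcyclic) AcyclicOk where
  bot V := SimpleGraph.isAcyclic_bot
  congr d x y y' h hy p hp := by
    rw [← h p hp]
    intro hx
    refine ⟨(hy p hp hx).1, fun p' hp' => ?_⟩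
    rw [← h p' hp']
    exact (hy p hp hx).2 p' hp'
  sound V G N z hG hz v y hy p hp := by
    rw [hy p hp]
    intro hid
    have hzz : z v = z (N.port v ⟨p, hp⟩) := N.id_injective hid
    have hadj := port_adj N v ⟨p, hp⟩
    have hr : G.Reachable (N.port v ⟨p, hp⟩ : V) (z v) := hzz ▸ hz _
    simp only [← hzz]
    refine ⟨dist_ne_of_adj_of_isAcyclic hG hadj (hz v) hr, fun p' hp' => ?_⟩
    rw [hy p' hp']
    intro hid' hd hd'
    have hzz' : z v = z (N.port v ⟨p', hp'⟩) := N.id_injective hid'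
    have hadj' := port_adj N v ⟨p', hp'⟩
    have hr' : G.Reachable (N.port v ⟨p', hp'⟩ : V) (z v) := hzz' ▸ hz _
    simp only [← hzz'] at hd'
    have h1 := eq_of_adj_of_isAcyclic hG hadj hadj' hr hr' hd.le hd'.le
    simpa using (N.port v).injective (Subtype.ext h1)
  complete V G N x y hy hok := by
    refine isAcyclic_of_depth (fun v => (x v).2) ?_ ?_
    · rintro v u ⟨hadj, hvu⟩
      obtain ⟨p, hp, rfl⟩ := exists_port N hadj
      have h1 := hok v p hp
      rw [hy v p hp] at h1
      exact (h1 hvu).1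
    · rintro v u u' ⟨hadj, hvu⟩ ⟨hadj', hvu'⟩ hlt hlt'
      obtain ⟨p, hp, rfl⟩ := exists_port N hadj
      obtain ⟨p', hp', rfl⟩ := exists_port N hadj'
      have h1 := hok v p hp
      rw [hy v p hp] at h1
      have h2 := (h1 hvu).2 p' hp'
      rw [hy v p' hp'] at h2
      have h3 := h2 hvu' hlt hlt'
      subst h3
      rfl


/-! ### Correctness and rejection probability of the tester -/

theorem two_thirds_le_ncard_div {Ω : Type*} [Fintype Ω] [Nonempty Ω] [DecidableEq Ω] {S : Set Ω}
    {T : Finset Ω} (hS : ((Tᶜ : Finset Ω) : Set Ω) ⊆ S) (hT : (#T : ℝ) ≤ Fintype.card Ω / 3) :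
    2 / 3 ≤ (S.ncard : ℝ) / (Nat.card Ω : ℝ) := by
  have hc0 : (0 : ℝ) < Fintype.card Ω := by exact_mod_cast Fintype.card_pos
  have h1 : (#Tᶜ : ℝ) ≤ S.ncard := by
    rw [← Set.ncard_coe_finset]
    exact_mod_cast Set.ncard_le_ncard hS (Set.toFinite _)
  rw [card_compl, Nat.cast_sub (card_le_univ _)] at h1
  rw [Nat.card_eq_fintype_card, le_div_iff₀ hc0]
  linarith

section Tester

variable {V : Type u} [Fintype V] {G : SimpleGraph V} (N : Network G) {K R B j : ℕ}
  {P : ∀ V : Type u, SimpleGraph V → Prop} {ok : ℕ → ℕ × ℕ → (ℕ → ℕ × ℕ) → Prop}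
  (hP : IsCertificate P ok) (hid : ∀ v, N.id v < K) (hB : K * (R + 1) ^ 2 ≤ 2 ^ B)
include hP hid hB

omit [Fintype V] in
theorem result_of_property (hG : P V G) (ω : V → Fin (R * j) → Bool) (v : V) :
    (floodProgram K R B (R * j) (blockRadius R j) ok).result N ω v = true := by
  have hr := (isGeometric_blockRadius R j).le
  choose z hz hzid hzd using exists_isCenter (ok := ok) N ω hid hr hB
  rw [result_eq_true_iff N ω hid hr hB hP.congr v (y := fun p => if hp : p < N.deg v then
    (N.id (z (N.port v ⟨p, hp⟩)), G.dist (N.port v ⟨p, hp⟩) (z (N.port v ⟨p, hp⟩))) else (0, 0)),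
    hzid, hzd]
  · exact hP.sound V G N z hG (fun v => (hz v).1) v _ fun p hp => by rw [dif_pos hp]
  · intro p hp
    rw [dif_pos hp, hzid, hzd]

omit [Fintype V] in
theorem property_of_result (ω : V → Fin (R * j) → Bool)
    (h : ∀ v, (floodProgram K R B (R * j) (blockRadius R j) ok).result N ω v = true) :
    P V (clusterGraph G fun v => tokenId K R (held N K R B (blockRadius R j) ok ω R v)) := by
  have hr := (isGeometric_blockRadius R j).le
  set x : V → ℕ × ℕ := fun v => (tokenId K R (held N K R B (blockRadius R j) ok ω R v),
    tokenDist R (held N K R B (blockRadius R j) ok ω R v))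
  refine hP.complete V G N x (fun v p => if hp : p < N.deg v then x (N.port v ⟨p, hp⟩) else (0, 0))
    (fun v p hp => by rw [dif_pos hp]) fun v => ?_
  rw [← result_eq_true_iff N ω hid hr hB hP.congr v]
  · exact h v
  · intro p hp
    rw [dif_pos hp]

omit hP in
open Classical in
/-- An edge is cut with probability at most `2 / 2 ^ j`. -/
theorem card_cut_le (hR : Fintype.card V * (1 - 1 / 2 ^ j : ℝ) ^ R ≤ 1 / 2 ^ j)
    {e : Sym2 V} (he : e ∈ G.edgeSet) :
    (#{ω : V → Fin (R * j) → Bool | e ∉ (clusterGraph G fun v =>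
      tokenId K R (held N K R B (blockRadius R j) ok ω R v)).edgeSet} : ℝ) ≤
      2 / 2 ^ j * Fintype.card (V → Fin (R * j) → Bool) := by
  have hg := isGeometric_blockRadius R j
  induction e using Sym2.inductionOn with | hf u v => ?_
  rw [SimpleGraph.mem_edgeSet] at he
  have : Nonempty V := ⟨u⟩
  have hp1 : (1 : ℝ) / 2 ^ j ≤ 1 := by
    rw [div_le_one (by positivity)]
    exact one_le_pow₀ one_le_two
  have hp0 : (0 : ℝ) ≤ 1 / 2 ^ j := by positivity
  have h1 := hg.card_exists_leads (by linarith) (by linarith) N.id_injective hid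
    (edgeDist G R u v)
  have h2 : #{ω : V → Fin (R * j) → Bool | s(u, v) ∉ (clusterGraph G fun v =>
        tokenId K R (held N K R B (blockRadius R j) ok ω R v)).edgeSet} +
      #{ω : V → Fin (R * j) → Bool | ∃ w, Leads N.id (fun v => blockRadius R j (ω v))
        (edgeDist G R u v) K 1 w} ≤ Fintype.card (V → Fin (R * j) → Bool) := by
    rw [← card_union_of_disjoint]
    · exact card_le_univ _
    · refine disjoint_left.2 fun ω hω hω' => (mem_filter.1 hω).2 ?_
      obtain ⟨w, hw⟩ := (mem_filter.1 hω').2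
      have hc := hw.isCenter_of_adj hid (fun v => hg.le (ω v)) he
      obtain ⟨w₁, h₁, e₁, -⟩ := exists_isCenter (ok := ok) N ω hid hg.le hB u
      obtain ⟨w₂, h₂, e₂, -⟩ := exists_isCenter (ok := ok) N ω hid hg.le hB v
      refine ⟨he, ?_⟩
      dsimp only
      rw [e₁, e₂, h₁.id_eq hid hc.1, h₂.id_eq hid hc.2]
  have h3 : (#{ω : V → Fin (R * j) → Bool | s(u, v) ∉ (clusterGraph G fun v =>
        tokenId K R (held N K R B (blockRadius R j) ok ω R v)).edgeSet} : ℝ) +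
      #{ω : V → Fin (R * j) → Bool | ∃ w, Leads N.id (fun v => blockRadius R j (ω v))
        (edgeDist G R u v) K 1 w} ≤ Fintype.card (V → Fin (R * j) → Bool) := by
    exact_mod_cast h2
  have h4 := mul_le_mul_of_nonneg_right hR
    (Nat.cast_nonneg (α := ℝ) (Fintype.card (V → Fin (R * j) → Bool)))
  -- One term is the failure of memorylessness to add a step, the other the truncation at `R` summed
  -- over all centers.
  have h5 : (2 : ℝ) / 2 ^ j = 1 / 2 ^ j + 1 / 2 ^ j := by ring
  rw [h5]
  linarith

theorem two_thirds_le_prob {ε : ℝ} (hε : 0 < ε) (hj : 6 / ε ≤ 2 ^ j)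
    (hR : Fintype.card V * (1 - 1 / 2 ^ j : ℝ) ^ R ≤ 1 / 2 ^ j) (hG : ¬ P V G)
    (hfar : ∀ H : SimpleGraph V, P V H →
      ε * (G.edgeSet.ncard : ℝ) ≤ ((symmDiff G.edgeSet H.edgeSet).ncard : ℝ)) :
    2 / 3 ≤ (floodProgram K R B (R * j) (blockRadius R j) ok).prob
      {ω : V → Fin (R * j) → Bool |
        ∃ v, (floodProgram K R B (R * j) (blockRadius R j) ok).result N ω v = false} := by
  classical
  set H : (V → Fin (R * j) → Bool) → SimpleGraph V := fun ω =>
    clusterGraph G fun v => tokenId K R (held N K R B (blockRadius R j) ok ω R v)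
  set c : ℝ := (Fintype.card (V → Fin (R * j) → Bool) : ℝ)
  have hE : 0 < #G.edgeFinset := by
    rw [card_pos, SimpleGraph.edgeFinset_nonempty]
    rintro rfl
    exact hG (hP.bot V)
  have hE' : (0 : ℝ) < #G.edgeFinset := by exact_mod_cast hE
  have hcard : G.edgeSet.ncard = #G.edgeFinset := by
    rw [← SimpleGraph.coe_edgeFinset, Set.ncard_coe_finset]
  obtain ⟨cut, hcut⟩ : ∃ cut : (V → Fin (R * j) → Bool) → Sym2 V → Prop,
      ∀ ω e, cut ω e ↔ e ∉ (H ω).edgeSet := ⟨_, fun _ _ => Iff.rfl⟩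
  have hmarkov := card_filter_mul_le G.edgeFinset cut (δ := 2 / 2 ^ j) (fun e he => by
    simp only [hcut]
    exact card_cut_le N hid hB hR (SimpleGraph.mem_edgeFinset.1 he)) (ε * #G.edgeFinset)
  set bad := ({ω | ε * #G.edgeFinset ≤ #{e ∈ G.edgeFinset | cut ω e}} :
    Finset (V → Fin (R * j) → Bool))
  have hbad3 : (#bad : ℝ) ≤ c / 3 := by
    have h1 : (2 : ℝ) / 2 ^ j ≤ ε / 3 := by
      rw [div_le_iff₀ (by positivity)]
      rw [div_le_iff₀ hε] at hj
      linarith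
    have h2 : ε * #G.edgeFinset * #bad ≤ ε * #G.edgeFinset * (c / 3) := by
      refine hmarkov.trans ?_
      calc _ ≤ ε / 3 * #G.edgeFinset * c := by gcongr
        _ = _ := by ring
    exact le_of_mul_le_mul_left h2 (by positivity)
  -- If all accept, the cluster graph has the property and differs from `G` exactly in the cut
  -- edges, so farness makes `ω` bad.
  have hsub : ((badᶜ : Finset _) : Set (V → Fin (R * j) → Bool)) ⊆ {ω |
      ∃ v, (floodProgram K R B (R * j) (blockRadius R j) ok).result N ω v = false} := by
    intro ω hω
    by_contra hacc
    simp only [Set.mem_ofPred_eq, not_exists, Bool.not_eq_false] at hacc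
    have h1 := hfar _ (property_of_result N hP hid hB ω hacc)
    have h2 : symmDiff G.edgeSet (H ω).edgeSet =
        (({e ∈ G.edgeFinset | cut ω e} : Finset (Sym2 V)) : Set (Sym2 V)) := by
      have hle : (H ω).edgeSet ⊆ G.edgeSet :=
        SimpleGraph.edgeSet_mono fun _ _ h => h.1
      rw [Set.symmDiff_def, Set.sdiff_eq_empty.2 hle, Set.union_empty]
      ext e
      simp [hcut]
    change _ ≤ ((symmDiff G.edgeSet (H ω).edgeSet).ncard : ℝ) at h1
    rw [h2, Set.ncard_coe_finset, hcard] at h1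
    rw [mem_coe, mem_compl] at hω
    exact hω (mem_filter.2 ⟨mem_univ _, h1⟩)
  exact two_thirds_le_ncard_div hsub hbad3

end Tester

/-! ### Parameters -/

/-- The program that accepts at once. -/
def acceptProgram : Program where
  bandwidth := 0
  rounds := 0
  coins := 0
  State := Unit
  init _ _ _ := ()
  send _ _ := Message.empty 0
  receive s _ := s
  output _ := true

theorem exists_two_pow_between {x : ℝ} (hx : 1 ≤ x) : ∃ j : ℕ, x ≤ 2 ^ j ∧ (2 : ℝ) ^ j ≤ 2 * x := by
  obtain ⟨j, h1, h2⟩ := exists_nat_pow_near hx one_lt_two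
  exact ⟨j + 1, h2.le, by rw [pow_succ]; linarith⟩

theorem half_le_log {n : ℕ} (hn : 2 ≤ n) : 1 / 2 ≤ Real.log n := by
  have h1 : Real.log 2 ≤ Real.log n := Real.log_le_log two_pos (by exact_mod_cast hn)
  linarith [Real.log_two_gt_d9]

/-- Parameters of the flooding program, for `6 / ε ≤ 2 ^ j ≤ 12 / ε` and `ε ≥ 1 / n ^ 2`. -/
theorem radius_bounds {n j R : ℕ} (hn : 2 ≤ n) {ε : ℝ} (hε : 1 / (n : ℝ) ^ 2 ≤ ε)
    (hj : (2 : ℝ) ^ j ≤ 12 / ε) (hR : R = ⌈7 * Real.log n * 2 ^ j⌉₊) :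
    n * (1 - 1 / 2 ^ j : ℝ) ^ R ≤ 1 / 2 ^ j ∧ (R : ℝ) + 1 ≤ 84 * (Real.log n / ε) + 2 ∧
      R + 1 ≤ n ^ 10 := by
  have hn' : (2 : ℝ) ≤ n := by exact_mod_cast hn
  have hn0 : (0 : ℝ) < n := by linarith
  have hlog := half_le_log hn
  have hε0 : 0 < ε := lt_of_lt_of_le (by positivity) hε
  have hRge : 7 * Real.log n * 2 ^ j ≤ R := hR ▸ Nat.le_ceil _
  have hRlt : (R : ℝ) < 7 * Real.log n * 2 ^ j + 1 := hR ▸ Nat.ceil_lt_add_one (by positivity)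
  have hjn : (2 : ℝ) ^ j ≤ 12 * n ^ 2 := by
    refine hj.trans ?_
    rw [div_le_iff₀ hε0]
    rw [div_le_iff₀ (by positivity)] at hε
    linarith
  have hR2 : (R : ℝ) + 1 ≤ 84 * (Real.log n / ε) + 2 := by
    have : 7 * Real.log n * 2 ^ j ≤ 7 * Real.log n * (12 / ε) := by gcongr
    have h2 : 7 * Real.log n * (12 / ε) = 84 * (Real.log n / ε) := by ring
    linarith
  refine ⟨?_, hR2, ?_⟩
  · have hp1 : (1 : ℝ) / 2 ^ j ≤ 1 := by
      rw [div_le_one (by positivity)]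
      exact one_le_pow₀ one_le_two
    have h1 : (1 - 1 / 2 ^ j : ℝ) ^ R ≤ ((n : ℝ) ^ 7)⁻¹ := by
      calc (1 - 1 / 2 ^ j : ℝ) ^ R ≤ Real.exp (-(1 / 2 ^ j)) ^ R := by
            refine pow_le_pow_left₀ (by linarith) (Real.one_sub_le_exp_neg _) _
        _ = Real.exp (-(R / 2 ^ j)) := by rw [← Real.exp_nat_mul]; congr 1; ring
        _ ≤ Real.exp (-(7 * Real.log n)) := by
            gcongr
            rw [le_div_iff₀ (by positivity)]
            exact hRge
        _ = ((n : ℝ) ^ 7)⁻¹ := by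
            rw [Real.exp_neg]
            congr 1
            have : 7 * Real.log n = ((7 : ℕ) : ℝ) * Real.log n := by norm_num
            rw [this, Real.exp_nat_mul, Real.exp_log hn0]
    -- The factor `7` in `R` leaves `n ^ 6`, which dominates `2 ^ j ≤ 12 * n ^ 2` because `n ^ 4 ≥
    -- 16`.
    calc n * (1 - 1 / 2 ^ j : ℝ) ^ R ≤ n * ((n : ℝ) ^ 7)⁻¹ := by gcongr
      _ = 1 / (n : ℝ) ^ 6 := by field_simp
      _ ≤ 1 / 2 ^ j := by
        refine one_div_le_one_div_of_le (by positivity) (hjn.trans ?_)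
        have : (2 : ℝ) ^ 4 ≤ (n : ℝ) ^ 4 := by gcongr
        calc 12 * (n : ℝ) ^ 2 ≤ (n : ℝ) ^ 4 * n ^ 2 := by
              gcongr
              linarith
          _ = (n : ℝ) ^ 6 := by ring
  · have hlogn : Real.log n ≤ n := (Real.log_le_sub_one_of_pos hn0).trans (by linarith)
    have h1 : 7 * Real.log n * 2 ^ j ≤ 7 * n * (12 * n ^ 2) := by gcongr
    have h2 : (2 : ℝ) ^ 3 ≤ (n : ℝ) ^ 3 := by gcongr
    have h3 : (2 : ℝ) ^ 7 ≤ (n : ℝ) ^ 7 := by gcongr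
    have h4 : (2 : ℝ) ^ 7 * n ^ 3 ≤ n ^ 7 * n ^ 3 := by gcongr
    have h5 : (R : ℝ) + 1 ≤ (n : ℝ) ^ 10 := by nlinarith
    exact_mod_cast h5

theorem bandwidth_bounds {n : ℕ} (hn : 2 ≤ n) (k : ℕ) :
    n ^ (k + 20) ≤ 2 ^ ((k + 20) * (Nat.log 2 n + 1)) ∧
      (((k + 20) * (Nat.log 2 n + 1) : ℕ) : ℝ) ≤ 4 * (k + 20) * Real.log n := by
  constructor
  · rw [mul_comm, pow_mul]
    exact Nat.pow_le_pow_left (Nat.lt_pow_succ_log_self one_lt_two n).le _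
  · have h1 : ((2 : ℝ) ^ Nat.log 2 n) ≤ n := by
      exact_mod_cast Nat.pow_log_le_self 2 (by omega)
    have h2 := Real.log_le_log (by positivity) h1
    rw [Real.log_pow] at h2
    have h3 : (1 : ℝ) ≤ Nat.log 2 n := by
      exact_mod_cast Nat.log_pos one_lt_two hn
    have h4 : (Nat.log 2 n : ℝ) + 1 ≤ 4 * Real.log n := by
      nlinarith [Real.log_two_gt_d9]
    push_cast
    calc ((k : ℝ) + 20) * (Nat.log 2 n + 1) ≤ (k + 20) * (4 * Real.log n) := by gcongr
      _ = _ := by ring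

theorem ncard_edgeSet_le {V : Type u} [Fintype V] (G : SimpleGraph V) :
    G.edgeSet.ncard ≤ Fintype.card V ^ 2 := by
  classical
  rw [← SimpleGraph.coe_edgeFinset, Set.ncard_coe_finset]
  exact SimpleGraph.card_edgeFinset_le_card_choose_two.trans (Nat.choose_le_pow _ _)

/-- Being `ε`-far implies being `1 / |V| ^ 2`-far. -/
theorem IsFar.max_le {V : Type u} [Fintype V] {P : SimpleGraph V → Prop} {G : SimpleGraph V}
    {ε : ℝ} (h : IsFar P ε G) (H : SimpleGraph V) (hH : P H) :
    max ε (1 / (Fintype.card V : ℝ) ^ 2) * (G.edgeSet.ncard : ℝ) ≤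
      ((symmDiff G.edgeSet H.edgeSet).ncard : ℝ) := by
  rcases le_total ε (1 / (Fintype.card V : ℝ) ^ 2) with hle | hle
  · rw [max_eq_right hle]
    -- Since `G` lacks the property, at least one edge must change, while `|E| ≤ |V| ^ 2`.
    have h1 : (1 : ℝ) ≤ (symmDiff G.edgeSet H.edgeSet).ncard := by
      rw [Nat.one_le_cast, Nat.one_le_iff_ne_zero, Ne, Set.ncard_eq_zero (Set.toFinite _)]
      intro h0
      have := symmDiff_eq_bot.1 h0
      exact h.1 (SimpleGraph.edgeSet_injective this ▸ hH)
    refine le_trans ?_ h1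
    rw [one_div, inv_mul_eq_div]
    refine div_le_one_of_le₀ ?_ (by positivity)
    exact_mod_cast ncard_edgeSet_le G
  · rw [max_eq_left hle]
    exact h.2 H hH

/-- A graph with at most one vertex is never `ε`-far, and no graph is `ε`-far if `ε > 1`. -/
theorem not_isFar {V : Type u} [Fintype V] {P : SimpleGraph V → Prop} (hP : P ⊥)
    {G : SimpleGraph V} {ε : ℝ} (h : Fintype.card V < 2 ∨ 1 < ε) : ¬ IsFar P ε G := by
  rintro ⟨hG, hfar⟩
  apply hG
  suffices G = ⊥ by rwa [this]
  rcases h with h | h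
  · have : Subsingleton V := Fintype.card_le_one_iff_subsingleton.1 (by omega)
    exact Subsingleton.elim _ _
  · have h1 := hfar ⊥ hP
    rw [SimpleGraph.edgeSet_bot, ← Set.bot_eq_empty, symmDiff_bot] at h1
    rw [← SimpleGraph.edgeSet_eq_empty, ← Set.ncard_eq_zero (Set.toFinite _)]
    by_contra h0
    have : (0 : ℝ) < G.edgeSet.ncard := by exact_mod_cast Nat.pos_of_ne_zero h0
    nlinarith

theorem IsCertificate.hasLogTester {P : ∀ V : Type u, SimpleGraph V → Prop}
    {ok : ℕ → ℕ × ℕ → (ℕ → ℕ × ℕ) → Prop} (hP : IsCertificate P ok) : HasLogTester P := by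
  refine ⟨88, fun k => ⟨4 * (k + 20), fun ε hε => ?_⟩⟩
  have key : ∀ n : ℕ, ∃ A : Program, (A.bandwidth : ℝ) ≤ 4 * (k + 20) * Real.log n ∧
      (A.rounds : ℝ) ≤ 88 * (Real.log n / ε) ∧
      ∀ (V : Type u) [Fintype V], Fintype.card V = n → ∀ (G : SimpleGraph V) (N : Network G),
        (∀ v, N.id v < n ^ k) →
        (P V G → ∀ (ω : A.Coins V) (v : V), A.result N ω v = true) ∧
        (IsFar (P V) ε G → 2 / 3 ≤ A.prob {ω : A.Coins V | ∃ v, A.result N ω v = false}) := by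
    intro n
    have hlog0 : 0 ≤ Real.log n := Real.log_natCast_nonneg n
    by_cases htriv : n < 2 ∨ 1 < ε
    · refine ⟨acceptProgram, ?_, ?_, ?_⟩
      · simp only [acceptProgram, Nat.cast_zero]; positivity
      · simp only [acceptProgram, Nat.cast_zero]; positivity
      · intro V _ hV G N _
        exact ⟨fun _ _ _ => rfl, fun hfar => (not_isFar (hP.bot V) (hV ▸ htriv) hfar).elim⟩
    · push Not at htriv
      obtain ⟨hn, hε1⟩ := htriv
      have hn' : (2 : ℝ) ≤ n := by exact_mod_cast hn
      -- Raising `ε` to at least `1 / n ^ 2` keeps `R` polynomial in `n`, so that the message bound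
      -- does not depend on `ε`.
      set δ := max ε (1 / (n : ℝ) ^ 2) with hδ
      have hδ0 : 0 < δ := lt_max_of_lt_left hε
      have hδ1 : δ ≤ 1 := max_le hε1 (div_le_one_of_le₀ (one_le_pow₀ (by linarith)) (by positivity))
      obtain ⟨j, hj1, hj2⟩ := exists_two_pow_between (x := 6 / δ) (by
        rw [le_div_iff₀ hδ0]; linarith)
      obtain ⟨hR1, hR2, hR3⟩ := radius_bounds hn (le_max_right ε _) (j := j)
        (hj2.trans (le_of_eq (by ring))) rfl
      set R := ⌈7 * Real.log n * 2 ^ j⌉₊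
      obtain ⟨hB1, hB2⟩ := bandwidth_bounds hn k
      set B := (k + 20) * (Nat.log 2 n + 1)
      have hB : n ^ k * (R + 1) ^ 2 ≤ 2 ^ B := by
        refine le_trans ?_ hB1
        calc n ^ k * (R + 1) ^ 2 ≤ n ^ k * (n ^ 10) ^ 2 := by gcongr
          _ = n ^ (k + 20) := by ring
      refine ⟨floodProgram (n ^ k) R B (R * j) (blockRadius R j) ok, hB2, ?_, ?_⟩
      · change ((R + 1 : ℕ) : ℝ) ≤ _
        push_cast
        refine hR2.trans ?_
        have h1 : Real.log n / δ ≤ Real.log n / ε :=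
          div_le_div_of_nonneg_left hlog0 hε (le_max_left _ _)
        -- This absorbs the additive `2` of the round count into the constant: `84 + 4 = 88`. It
        -- needs `ε ≤ 1` and `n ≥ 2`, whence the separate trivial case.
        have h2 : 1 / 2 ≤ Real.log n / ε := by
          rw [le_div_iff₀ hε]
          have := half_le_log hn
          linarith
        linarith
      · intro V _ hV G N hid
        refine ⟨fun hG ω v => result_of_property N hP hid hB hG ω v, fun hfar => ?_⟩
        refine two_thirds_le_prob N hP hid hB hδ0 hj1 (hV ▸ hR1) hfar.1 fun H hH => ?_
        have := hfar.max_le H hH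
        rwa [hV] at this
  choose A hA1 hA2 hA3 using key
  exact ⟨A, hA1, hA2, fun V _ G N hid => hA3 _ V rfl G N hid⟩

end Congest

theorem mainTheorem2 :
    Congest.HasLogTester.{u} (fun _ G => G.IsBipartite) ∧
      Congest.HasLogTester.{u} (fun _ G => G.IsAcyclic) :=
  ⟨Congest.isCertificate_bipartiteOk.hasLogTester, Congest.isCertificate_acyclicOk.hasLogTester⟩
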